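/- For sets $A,B$ let $\langle A\rangle$ be the free abelian group on $A$, and let $L(A,B)\subseteq\operatorname{Hom}(\langle A\rangle,\langle B\rangle)$ be the subgroup generated by the homomorphisms that send every basis element of $\langle A\rangle$ to a basis element of $\langle B\rangle$ or to $0$. A map $a:A\to B$ induces $\langle a\rangle\in L(A,B)$. For topological spaces $X,Y$ let $[X,Y]$ be the set of homotopy classes of continuous maps $X\to Y$. For an abelian group $M$, a map $f:[X,Y]\to M$ is called a straight invariant if there is a homomorphism $F:L(X,Y)\to M$ such that $f([a])=F(\langle a\rangle)$ for all continuous $a:X\to Y$. Let $SX$ be the integral singular chain complex of $X$ and $[SX,SY]$ the abelian group of chain homotopy classes of chain maps $SX\to SY$; the main invariant is $h:[X,Y]\to[SX,SY]$, $[a]\mapsto[Sa]$. A space is valid if it is homotopy equivalent to a CW-complex, and finitary if it is weakly homotopy equivalent to a compact CW-complex. Let $X\subset\mathbb R^2$ be the Warsaw circle, that is, the union of the graph of $y=\sin(1/x)$ over $0<x\le 1/\pi$, the segment $\{0\}\times[-1,1]$, and the polygonal arc with successive vertices $(0,-1)$, $(0,-2)$, $(1/\pi,-2)$, $(1/\pi,0)$.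 Let $Y\subset\mathbb C$ be the unit circle, so that pointwise multiplication of maps makes $[X,Y]$ an abelian group. Then: 1. the map from $X$ to a point is a weak homotopy equivalence; in particular $X$ is finitary; but $X$ is not valid, whereas $Y$ is valid; 2. the main invariant $h:[X,Y]\to[SX,SY]$ is constant; 3. there is a nonzero group homomorphism $f:[X,Y]\to\mathbb Q$ that is a straight invariant and for which there is no homomorphism $d:[SX,SY]\to\mathbb Q$ with $f=d\circ h$. Thus the hypothesis that $X$ is valid cannot be omitted from the theorem that, for finitary valid $X$ and valid $Y$, every straight invariant of $[X,Y]$ has the form $d\circ h$ with a homomorphism $d$ defined on $[SX,SY]$. -/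

import Mathlib

open CategoryTheory

noncomputable section

namespace StraightInvariants

/-! ### Homotopy classes of maps and straight invariants -/

/-- `[X, Y]`: the set of homotopy classes of continuous maps `X → Y`. -/
def HomotopyClasses (X Y : Type*) [TopologicalSpace X] [TopologicalSpace Y] : Type _ :=
  Quotient (⟨ContinuousMap.Homotopic, ContinuousMap.Homotopic.equivalence⟩ : Setoid C(X, Y))

/-- The homotopy class `[a]` of a continuous map `a`. -/
def HomotopyClasses.mk {X Y : Type*} [TopologicalSpace X] [TopologicalSpace Y] (a : C(X, Y)) :
    HomotopyClasses X Y :=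
  Quotient.mk _ a

/-- `L(X, Y)`: the subgroup of `Hom(⟨X⟩, ⟨Y⟩)` generated by the homomorphisms that send every
basis element of the free abelian group `⟨X⟩` to a basis element of `⟨Y⟩` or to zero. -/
def L (X Y : Type*) : AddSubgroup (FreeAbelianGroup X →+ FreeAbelianGroup Y) :=
  AddSubgroup.closure
    {u | ∀ x : X, u (FreeAbelianGroup.of x) ∈ Set.range (FreeAbelianGroup.of (α := Y)) ∪ {0}}

/-- The element `⟨a⟩` of `L(X, Y)` induced by a map `a`; it sends `⟨x⟩` to `⟨a x⟩`. -/
def L.ofMap {X Y : Type*} (a : X → Y) : L X Y :=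
  ⟨FreeAbelianGroup.map a, AddSubgroup.subset_closure fun x =>
    Or.inl ⟨a x, (FreeAbelianGroup.map_of_apply x).symm⟩⟩

/-- An invariant `f : [X, Y] → M` is straight if `f [a] = F ⟨a⟩` for some homomorphism
`F : L(X, Y) → M` and all continuous `a : X → Y`. -/
def IsStraight {X Y M : Type*} [TopologicalSpace X] [TopologicalSpace Y] [AddCommGroup M]
    (f : HomotopyClasses X Y → M) : Prop :=
  ∃ F : L X Y →+ M, ∀ a : C(X, Y), f (HomotopyClasses.mk a) = F (L.ofMap a)

/-! ### The main invariant -/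

/-- The integral singular chain complex functor. -/
abbrev singularChains : TopCat.{0} ⥤ ChainComplex AddCommGrpCat.{0} ℕ :=
  (AlgebraicTopology.singularChainComplexFunctor AddCommGrpCat.{0}).obj (AddCommGrpCat.of ℤ)

/-- The singular chain complex `SX` as an object of the homotopy category of chain complexes. -/
abbrev singularChainsUpToHomotopy (X : Type) [TopologicalSpace X] :
    HomotopyCategory AddCommGrpCat.{0} (ComplexShape.down ℕ) :=
  (HomotopyCategory.quotient _ _).obj (singularChains.obj (TopCat.of X))

/-- `[SX, SY]`: the abelian group of chain homotopy classes of chain maps `SX → SY`. -/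
abbrev ChainHomotopyClasses (X Y : Type) [TopologicalSpace X] [TopologicalSpace Y] : Type :=
  singularChainsUpToHomotopy X ⟶ singularChainsUpToHomotopy Y

/-- The main invariant `h : [X, Y] → [SX, SY]`, `[a] ↦ [Sa]`. -/
def mainInvariant {X Y : Type} [TopologicalSpace X] [TopologicalSpace Y] :
    HomotopyClasses X Y → ChainHomotopyClasses X Y :=
  Quotient.lift
    (fun a : C(X, Y) => (HomotopyCategory.quotient _ _).map (singularChains.map (TopCat.ofHom a)))
    (fun a b hab => HomotopyCategory.eq_of_homotopy _ _
      (TopCat.Homotopy.singularChainComplexFunctorObjMap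
        (f := TopCat.ofHom a) (g := TopCat.ofHom b) (Classical.choice hab) (AddCommGrpCat.of ℤ)))

/-! ### Valid and finitary spaces -/

/-- The map induced by a continuous map on sets of path components. -/
def pi0Map {X Y : Type*} [TopologicalSpace X] [TopologicalSpace Y] (f : C(X, Y)) :
    ZerothHomotopy X → ZerothHomotopy Y :=
  ZerothHomotopy.lift (fun x => ZerothHomotopy.mk (f x))
    fun _ _ p => ZerothHomotopy.sound (p.map f.continuous)

/-- The map `πₙ(X, x) → πₙ(Y, f x)` induced by a continuous map `f`. -/
def piMap {X Y : Type*} [TopologicalSpace X] [TopologicalSpace Y] (f : C(X, Y)) (n : ℕ) (x : X) :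
    HomotopyGroup.Pi n X x → HomotopyGroup.Pi n Y (f x) :=
  Quotient.map (fun p => ⟨f.comp p.1, fun y hy => congrArg f (p.2 y hy)⟩)
    fun _ _ h => h.map fun H => H.compContinuousMap f

/-- Weak homotopy equivalences: bijective on path components and on all homotopy groups, at all
base points. -/
def IsWeakHomotopyEquiv {X Y : Type*} [TopologicalSpace X] [TopologicalSpace Y] (f : C(X, Y)) :
    Prop :=
  Function.Bijective (pi0Map f) ∧
    ∀ (n : ℕ) (x : X), Function.Bijective (piMap f (n + 1) x)

/-- Two spaces are weakly homotopy equivalent if they are connected by a zigzag of weak homotopy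
equivalences. -/
def WeaklyHomotopyEquivalent (X Y : Type) [TopologicalSpace X] [TopologicalSpace Y] : Prop :=
  Relation.EqvGen (fun A B : TopCat.{0} => ∃ f : C(A, B), IsWeakHomotopyEquiv f)
    (TopCat.of X) (TopCat.of Y)

/-- A space that admits the structure of a CW-complex. -/
def IsCWComplex (K : Type) [TopologicalSpace K] : Prop :=
  T2Space K ∧ Nonempty (Topology.CWComplex (Set.univ : Set K))

/-- A space is valid if it is homotopy equivalent to a CW-complex. -/
def IsValid (X : Type) [TopologicalSpace X] : Prop :=
  ∃ (K : Type) (_ : TopologicalSpace K), IsCWComplex K ∧ Nonempty (ContinuousMap.HomotopyEquiv X K)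

/-- A space is finitary if it is weakly homotopy equivalent to a compact CW-complex. -/
def IsFinitary (X : Type) [TopologicalSpace X] : Prop :=
  ∃ (K : Type) (_ : TopologicalSpace K),
    IsCWComplex K ∧ CompactSpace K ∧ WeaklyHomotopyEquivalent X K

/-! ### The Warsaw circle -/

/-- The Warsaw circle as a subset of the plane: the graph of `sin (1 / x)` over `(0, 1 / π]`, the
segment `[-1, 1]` of the vertical axis, and a polygonal arc that joins the point `(0, -1)` of the
segment to the end `(1 / π, 0)` of the graph, with corners at `(0, -2)` and `(1 / π, -2)`. -/
def warsawCircle : Set (ℝ × ℝ) :=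
  {p | 0 < p.1 ∧ p.1 ≤ 1 / Real.pi ∧ p.2 = Real.sin (1 / p.1)} ∪
    {0} ×ˢ Set.Icc (-1) 1 ∪
    ({0} ×ˢ Set.Icc (-2) (-1) ∪ Set.Icc 0 (1 / Real.pi) ×ˢ {-2} ∪
      {1 / Real.pi} ×ˢ Set.Icc (-2) 0)

end StraightInvariants

end

noncomputable section

namespace StraightInvariants

open Topology Real
open scoped unitInterval

/-! The continuous bijection `param` from a half-line to the Warsaw circle X is not a homeomorphism,
but every map to X from a locally path connected space lifts through it
(`continuous_paramInv_comp`). Simplices, cubes and CW-complexes therefore see X as a contractible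
half-line: homotopy groups vanish, `param` induces an isomorphism on singular chains, and h is
constant.

Maps out of X still see the circle. Along the half-line a map `a` to the circle has a continuous
angle. Far out on the graph, points approach the axis points of the same height, so the angle
difference of such pairs tends to a multiple of 2π: the degree, which is additive, homotopy
invariant, and 1 for `windOnce`. Hence X is not contractible, and so not valid.

The degree is straight because a linear relation among the ⟨a⟩ forces the same relation among
degrees (`sum_degree_eq_zero`): after subtracting a suitable branch of the argument, which
contributes nothing to the relation, the angle sum is seen to be locally constant on the half-line.
Divisibility of ℚ then extends the degree to all of L. -/

/-! ### The half-line parametrization. -/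

/-- The parameter at which the half-line parametrization of the Warsaw circle reaches the start
`(1 / π, 0)` of the graph of `sin (1 / x)`. -/
def graphStart : ℝ := 4 + 1 / π

/-- A parametrization of the Warsaw circle by the half-line `[-1, ∞)`, as a map to the plane: it
runs down the vertical axis, along the bottom, up the right edge and then leftwards along the
graph of `sin (1 / x)`. -/
def planeParam (t : ℝ) : ℝ × ℝ :=
  (min (max 0 (t - 2)) (1 / (π + max 0 (t - graphStart))),
    max (-2) (-t) + min 2 (max 0 (t - graphStart + 2)) + sin (π + max 0 (t - graphStart)))

theorem one_div_pi_pos : 0 < 1 / π := by positivity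

theorem one_div_pi_lt_one : 1 / π < 1 := by
  rw [div_lt_one pi_pos]; linarith [pi_gt_three]

theorem continuous_planeParam : Continuous planeParam := by
  have h : ∀ t : ℝ, π + max 0 (t - graphStart) ≠ 0 := fun t => by positivity
  unfold planeParam
  fun_prop (disch := exact h)

theorem planeParam_axis {t : ℝ} (h : t ≤ 2) : planeParam t = (0, -t) := by
  have := one_div_pi_pos
  have e : max 0 (t - graphStart) = 0 := max_eq_left (by rw [graphStart]; linarith)
  have e' : max 0 (t - graphStart + 2) = 0 := max_eq_left (by rw [graphStart]; linarith)
  rw [planeParam, e, e', max_eq_left (by linarith), max_eq_right (by linarith)]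
  simp [pi_pos.le]

theorem planeParam_bottom {t : ℝ} (h : 2 ≤ t) (h' : t ≤ 2 + 1 / π) :
    planeParam t = (t - 2, -2) := by
  have e : max 0 (t - graphStart) = 0 := max_eq_left (by rw [graphStart]; linarith)
  have e' : max 0 (t - graphStart + 2) = 0 := max_eq_left (by rw [graphStart]; linarith)
  rw [planeParam, e, e', max_eq_right (by linarith), max_eq_left (by linarith), add_zero,
    min_eq_left (by linarith)]
  simp

theorem planeParam_edge {t : ℝ} (h : 2 + 1 / π ≤ t) (h' : t ≤ graphStart) :
    planeParam t = (1 / π, t - graphStart) := by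
  have := one_div_pi_pos
  have hc : graphStart = 4 + 1 / π := rfl
  have e : max 0 (t - graphStart) = 0 := max_eq_left (by linarith)
  have e' : max 0 (t - graphStart + 2) = t - graphStart + 2 := max_eq_right (by linarith)
  rw [planeParam, e, e', max_eq_right (by linarith), max_eq_left (by linarith), add_zero,
    min_eq_right (by linarith), min_eq_right (by linarith), sin_pi]
  ext <;> simp

theorem planeParam_graph {t : ℝ} (h : graphStart ≤ t) :
    planeParam t = (1 / (π + (t - graphStart)), sin (π + (t - graphStart))) := by
  have := one_div_pi_pos
  have hc : graphStart = 4 + 1 / π := rfl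
  have e : max 0 (t - graphStart) = t - graphStart := max_eq_right (by linarith)
  have e' : max 0 (t - graphStart + 2) = t - graphStart + 2 := max_eq_right (by linarith)
  have e2 : 1 / (π + (t - graphStart)) ≤ 1 :=
    (one_div_le_one_div_of_le pi_pos (by linarith)).trans one_div_pi_lt_one.le
  rw [planeParam, e, e', max_eq_right (by linarith), max_eq_left (by linarith),
    min_eq_right (by linarith), min_eq_left (by linarith)]
  ext <;> simp

/-- The inverse of `planeParam`. -/
def planeParamInv (p : ℝ × ℝ) : ℝ :=
  if p.1 = 0 then -p.2
  -- This polynomial is the inverse on all three sides of the arc at once: it equals `-p.2` for `p.1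
  -- = 0`, `2 + p.1` for `p.2 = -2`, and `graphStart + p.2` for `p.1 = 1 / π`. Likewise the last
  -- formula serves both the right edge and the graph.
  else if p.2 < -1 then 2 + p.1 + (p.2 + 2) * (2 * π * p.1 - 1)
  else graphStart + p.2 - sin (1 / p.1) + 1 / p.1 - π

theorem mem_warsawCircle {p : ℝ × ℝ} : p ∈ warsawCircle ↔
    (p.1 = 0 ∧ -2 ≤ p.2 ∧ p.2 ≤ 1) ∨ (0 ≤ p.1 ∧ p.1 ≤ 1 / π ∧ p.2 = -2) ∨
    (p.1 = 1 / π ∧ -2 ≤ p.2 ∧ p.2 ≤ 0) ∨ (0 < p.1 ∧ p.1 ≤ 1 / π ∧ p.2 = sin (1 / p.1)) := by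
  obtain ⟨x, y⟩ := p
  simp only [warsawCircle, Set.mem_union, Set.mem_ofPred_eq, Set.mem_prod, Set.mem_singleton_iff,
    Set.mem_Icc]
  constructor
  · rintro ((h | h) | ((h | h) | h))
    · exact Or.inr (Or.inr (Or.inr h))
    · exact Or.inl ⟨h.1, by linarith [h.2.1], h.2.2⟩
    · exact Or.inl ⟨h.1, h.2.1, by linarith [h.2.2]⟩
    · exact Or.inr (Or.inl ⟨h.1.1, h.1.2, h.2⟩)
    · exact Or.inr (Or.inr (Or.inl h))
  · rintro (h | h | h | h)
    · rcases le_total (-1) y with h' | h'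
      · exact Or.inl (Or.inr ⟨h.1, h', h.2.2⟩)
      · exact Or.inr (Or.inl (Or.inl ⟨h.1, h.2.1, h'⟩))
    · exact Or.inr (Or.inl (Or.inr ⟨⟨h.1, h.2.1⟩, h.2.2⟩))
    · exact Or.inr (Or.inr h)
    · exact Or.inl (Or.inl h)

theorem planeParam_mem {t : ℝ} (h : -1 ≤ t) : planeParam t ∈ warsawCircle := by
  have := one_div_pi_pos
  have hc : graphStart = 4 + 1 / π := rfl
  rw [mem_warsawCircle]
  rcases le_total t 2 with h1 | h1
  · rw [planeParam_axis h1]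
    exact Or.inl ⟨rfl, by simp only; linarith, by simp only; linarith⟩
  rcases le_total t (2 + 1 / π) with h2 | h2
  · rw [planeParam_bottom h1 h2]
    exact Or.inr (Or.inl ⟨by simp only; linarith, by simp only; linarith, rfl⟩)
  rcases le_total t graphStart with h3 | h3
  · rw [planeParam_edge h2 h3]
    exact Or.inr (Or.inr (Or.inl ⟨rfl, by simp only; linarith, by simp only; linarith⟩))
  · rw [planeParam_graph h3]
    have hp : 0 < π + (t - graphStart) := by linarith [pi_pos]
    refine Or.inr (Or.inr (Or.inr ⟨by positivity, ?_, by simp⟩))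
    exact one_div_le_one_div_of_le pi_pos (by linarith)

theorem planeParamInv_axis {p : ℝ × ℝ} (h : p.1 = 0) : planeParamInv p = -p.2 := if_pos h

theorem planeParamInv_of_lt {p : ℝ × ℝ} (h : p.2 < -1) :
    planeParamInv p = 2 + p.1 + (p.2 + 2) * (2 * π * p.1 - 1) := by
  rw [planeParamInv]
  split_ifs with h0
  · rw [h0]; ring
  · rfl

/-- With `planeParamInv_of_lt` this gives continuous formulas on two open sets that cover all of the
Warsaw circle except the segment {0} × [-1, 1], the only place where continuity of the inverse is in
doubt. -/
theorem planeParamInv_of_gt {p : ℝ × ℝ} (hp : p ∈ warsawCircle) (h : 0 < p.1) (h' : -2 < p.2) :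
    planeParamInv p = graphStart + p.2 - sin (1 / p.1) + 1 / p.1 - π := by
  have hc : graphStart = 4 + 1 / π := rfl
  rw [planeParamInv, if_neg h.ne']
  split_ifs with h1
  · have h2 : p.1 = 1 / π := by
      rcases mem_warsawCircle.1 hp with h2 | h2 | h2 | h2
      · exact absurd h2.1 h.ne'
      · exact absurd h2.2.2 h'.ne'
      · exact h2.1
      · linarith [h2.2.2, neg_one_le_sin (1 / p.1)]
    rw [h2, hc, one_div_one_div, sin_pi]
    field_simp
    ring
  · rfl

theorem planeParamInv_planeParam {t : ℝ} (h : -1 ≤ t) : planeParamInv (planeParam t) = t := by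
  have := one_div_pi_pos
  have hc : graphStart = 4 + 1 / π := rfl
  have hm := planeParam_mem h
  rcases le_total t 2 with h1 | h1
  · rw [planeParam_axis h1, planeParamInv_axis rfl, neg_neg]
  rcases le_total t (2 + 1 / π) with h2 | h2
  · rw [planeParam_bottom h1 h2] at hm ⊢
    rw [planeParamInv_of_lt (by norm_num)]
    ring
  rcases le_total t graphStart with h3 | h3
  · rcases h2.eq_or_lt with rfl | h2
    · rw [planeParam_bottom h1 le_rfl] at hm ⊢
      rw [planeParamInv_of_lt (by norm_num)]
      ring
    rw [planeParam_edge h2.le h3] at hm ⊢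
    rw [planeParamInv_of_gt hm (by simpa using pi_pos) (by simp only; linarith)]
    simp
  · rw [planeParam_graph h3] at hm ⊢
    have hp : 0 < π + (t - graphStart) := by linarith [pi_pos]
    rw [planeParamInv_of_gt hm (by simp only; positivity)
      (by linarith [neg_one_le_sin (π + (t - graphStart))])]
    simp only [one_div_one_div]
    ring

theorem exists_planeParam_eq {p : ℝ × ℝ} (hp : p ∈ warsawCircle) :
    ∃ t, -1 ≤ t ∧ planeParam t = p := by
  have := one_div_pi_pos
  have hc : graphStart = 4 + 1 / π := rfl
  obtain ⟨x, y⟩ := p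
  rcases mem_warsawCircle.1 hp with ⟨h0, h1, h2⟩ | ⟨h0, h1, h2⟩ | ⟨h0, h1, h2⟩ | ⟨h0, h1, h2⟩ <;>
    simp only at h0 h1 h2
  · exact ⟨-y, by linarith, by rw [planeParam_axis (by linarith), h0, neg_neg]⟩
  · exact ⟨2 + x, by linarith, by
      rw [planeParam_bottom (by linarith) (by linarith), h2, add_sub_cancel_left]⟩
  · exact ⟨graphStart + y, by linarith, by
      rw [planeParam_edge (by linarith) (by linarith), h0, add_sub_cancel_left]⟩
  · have : π ≤ 1 / x := by rwa [le_one_div pi_pos h0]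
    exact ⟨graphStart + (1 / x - π), by linarith, by
      rw [planeParam_graph (by linarith), h2]; simp⟩

/-- The half-line that parametrizes the Warsaw circle. -/
abbrev HalfLine : Type := Set.Ici (-1 : ℝ)

/-- The continuous bijection from a half-line to the Warsaw circle. -/
def param : C(HalfLine, warsawCircle) where
  toFun t := ⟨planeParam t, planeParam_mem t.2⟩
  continuous_toFun := (continuous_planeParam.comp continuous_subtype_val).subtype_mk _

/-- The discontinuous inverse of `param`. -/
def paramInv (p : warsawCircle) : HalfLine :=
  ⟨planeParamInv p, by
    obtain ⟨t, ht, h⟩ := exists_planeParam_eq p.2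
    rw [← h, planeParamInv_planeParam ht]
    exact ht⟩

theorem paramInv_param (t : HalfLine) : paramInv (param t) = t :=
  Subtype.ext (planeParamInv_planeParam t.2)

theorem param_paramInv (p : warsawCircle) : param (paramInv p) = p := by
  obtain ⟨t, ht, h⟩ := exists_planeParam_eq p.2
  obtain rfl : param ⟨t, ht⟩ = p := Subtype.ext h
  rw [paramInv_param]

/-! ### Lifting maps from locally path connected spaces. -/

/-- The function `sin (1 / x)` takes the values `1` and `-1` at arbitrarily small positive `x`. -/
theorem exists_sin_one_div_eq (b : Bool) {r : ℝ} (hr : 0 < r) :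
    ∃ x, 0 < x ∧ x < r ∧ x < 1 / π ∧ sin (1 / x) = if b then 1 else -1 := by
  obtain ⟨n, hn⟩ := exists_nat_gt (1 / r)
  have hp := pi_gt_three
  have key : ∀ s, π / 2 ≤ s → sin s = (if b then 1 else -1) →
      ∃ x, 0 < x ∧ x < r ∧ x < 1 / π ∧ sin (1 / x) = if b then 1 else -1 := by
    intro s hs h
    have h1 : (n : ℝ) + 1 ≤ ((n + 1 : ℕ) : ℝ) * (2 * π) := by push_cast; nlinarith
    have h2 : 2 * π ≤ ((n + 1 : ℕ) : ℝ) * (2 * π) := by push_cast; nlinarith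
    have h3 : 0 < s + ((n + 1 : ℕ) : ℝ) * (2 * π) := by linarith
    refine ⟨1 / (s + ((n + 1 : ℕ) : ℝ) * (2 * π)), by positivity, ?_, ?_, ?_⟩
    · rw [one_div_lt h3 hr]; linarith
    · exact one_div_lt_one_div_of_lt pi_pos (by linarith)
    · rw [one_div_one_div, sin_add_nat_mul_two_pi, h]
  cases b
  · refine key (3 * π / 2) (by linarith) ?_
    rw [show 3 * π / 2 = π / 2 + π by ring, sin_add_pi]; simp
  · exact key (π / 2) le_rfl (by simp)

/-- A connected subset of the Warsaw circle that meets the segment `{0} × [-1, 1]` and stays close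
to the height of a common point is contained in the vertical axis. -/
theorem fst_eq_zero_of_isPreconnected {S : Set (ℝ × ℝ)} (hS : S ⊆ warsawCircle)
    (hc : _root_.IsPreconnected S) {p : ℝ × ℝ} (hp : p ∈ S) (h0 : p.1 = 0) (h1 : -1 ≤ p.2)
    (hb : ∀ q ∈ S, |q.2 - p.2| < 1) {q : ℝ × ℝ} (hq : q ∈ S) : q.1 = 0 := by
  by_contra hne
  have hpos : 0 < q.1 := by
    have := one_div_pi_pos
    rcases mem_warsawCircle.1 (hS hq) with h | h | h | h
    · exact absurd h.1 hne
    · exact lt_of_le_of_ne h.1 (Ne.symm hne)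
    · rw [h.1]; exact this
    · exact h.1
  -- On its way from `p` to `q` the set crosses this abscissa, where the graph has height 1 if `p.2
  -- ≤ 0` and -1 otherwise, hence at distance at least 1 from `p.2`.
  obtain ⟨x, hx0, hxq, hxp, hx⟩ := exists_sin_one_div_eq (decide (p.2 ≤ 0)) hpos
  have hI := hc.intermediate_value hp hq continuous_fst.continuousOn
  obtain ⟨s, hs, rfl⟩ := hI ⟨by rw [h0]; exact hx0.le, hxq.le⟩
  have hbs := abs_lt.1 (hb s hs)
  rcases mem_warsawCircle.1 (hS hs) with h | h | h | h
  · exact hx0.ne' h.1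
  · linarith [h.2.2]
  · exact hxp.ne h.1
  · rw [h.2.2, hx] at hbs
    by_cases hp2 : p.2 ≤ 0 <;> simp only [hp2, decide_true, decide_false, if_true] at hbs
    · linarith
    · simp at hbs; linarith

/-- The inverse of the parametrization is continuous along maps from locally path connected
spaces. -/
theorem continuous_paramInv_comp {Z : Type*} [TopologicalSpace Z] [LocallyPathConnectedSpace Z]
    (f : C(Z, warsawCircle)) : Continuous fun z => paramInv (f z) := by
  refine Continuous.subtype_mk (f := fun z => planeParamInv (f z)) ?_ _
  have hf : Continuous fun z => ((f z : ℝ × ℝ)) := continuous_subtype_val.comp f.continuous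
  have hf1 := continuous_fst.comp hf
  have hf2 := continuous_snd.comp hf
  simp only [Function.comp_def] at hf1 hf2
  rw [continuous_iff_continuousAt]
  intro z
  rcases lt_or_ge (f z).1.2 (-1) with h | h
  · have : (fun z => planeParamInv (f z)) =ᶠ[𝓝 z] fun z =>
        2 + (f z).1.1 + ((f z).1.2 + 2) * (2 * π * (f z).1.1 - 1) :=
      (hf2.continuousAt.eventually_lt continuousAt_const h).mono fun w hw =>
        planeParamInv_of_lt hw
    refine ContinuousAt.congr ?_ this.symm
    fun_prop
  by_cases h0 : (f z).1.1 = 0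
  -- On a path connected neighbourhood where the height varies by less than 1, the image cannot
  -- leave the axis, and there the inverse is minus the height.
  · obtain ⟨U, ⟨hU, hUc⟩, hUb⟩ := (path_connected_basis z).mem_iff.1
      ((hf2.continuousAt.sub continuousAt_const).abs.eventually_lt
        (continuousAt_const (y := (1 : ℝ))) (by simp : |(f z).1.2 - (f z).1.2| < 1))
    have : (fun z => planeParamInv (f z)) =ᶠ[𝓝 z] fun z => -(f z).1.2 := by
      filter_upwards [hU] with w hw
      refine planeParamInv_axis (fst_eq_zero_of_isPreconnected
        (S := (fun z => (f z : ℝ × ℝ)) '' U) ?_ ?_ ⟨z, mem_of_mem_nhds hU, rfl⟩ h0 h ?_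
        ⟨w, hw, rfl⟩)
      · rintro _ ⟨u, -, rfl⟩; exact (f u).2
      · exact hUc.isConnected.isPreconnected.image _ hf.continuousOn
      · rintro _ ⟨u, hu, rfl⟩; exact hUb hu
    refine ContinuousAt.congr ?_ this.symm
    fun_prop
  · have hpos : 0 < (f z).1.1 := by
      have := one_div_pi_pos
      rcases mem_warsawCircle.1 (f z).2 with h | h | h | h
      · exact absurd h.1 h0
      · exact lt_of_le_of_ne h.1 (Ne.symm h0)
      · rw [h.1]; exact this
      · exact h.1
    have : (fun z => planeParamInv (f z)) =ᶠ[𝓝 z] fun z =>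
        graphStart + (f z).1.2 - sin (1 / (f z).1.1) + 1 / (f z).1.1 - π := by
      filter_upwards [continuousAt_const.eventually_lt hf2.continuousAt
        (by linarith : (-2 : ℝ) < (f z).1.2), continuousAt_const.eventually_lt hf1.continuousAt hpos]
        with w hw hw'
      exact planeParamInv_of_gt (f w).2 hw' hw
    refine ContinuousAt.congr ?_ this.symm
    have : ContinuousAt (fun z => 1 / (f z).1.1) z :=
      continuousAt_const.div hf1.continuousAt hpos.ne'
    fun_prop

/-- The lift to the half-line of a map from a locally path connected space. -/
def liftParam {Z : Type*} [TopologicalSpace Z] [LocallyPathConnectedSpace Z]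
    (f : C(Z, warsawCircle)) : C(Z, HalfLine) :=
  ⟨fun z => paramInv (f z), continuous_paramInv_comp f⟩

theorem param_comp_liftParam {Z : Type*} [TopologicalSpace Z] [LocallyPathConnectedSpace Z]
    (f : C(Z, warsawCircle)) : param.comp (liftParam f) = f :=
  ContinuousMap.ext fun z => param_paramInv (f z)

instance : ContractibleSpace HalfLine :=
  (convex_Ici (-1 : ℝ)).contractibleSpace ⟨0, by simp⟩

instance : LocallyPathConnectedSpace HalfLine := (convex_Ici (-1 : ℝ)).locallyPathConnectedSpace

/-- CW-complexes are locally path connected. -/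
theorem IsCWComplex.locallyPathConnectedSpace {K : Type} [TopologicalSpace K]
    (hK : IsCWComplex K) : LocallyPathConnectedSpace K := by
  obtain ⟨_, ⟨hCW⟩⟩ := hK
  let B := fun a : Σ n, RelCWComplex.cell (Set.univ : Set K) n =>
    Metric.closedBall (0 : Fin a.1 → ℝ) 1
  have hB : ∀ a, LocallyPathConnectedSpace (B a) := fun a =>
    (convex_closedBall (0 : Fin a.1 → ℝ) 1).locallyPathConnectedSpace
  have hB' : ∀ a, CompactSpace (B a) := fun a => isCompact_iff_compactSpace.1 (isCompact_closedBall _ _)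
  -- The characteristic maps make K a quotient of a disjoint union of closed balls, and local path
  -- connectedness passes to quotients.
  let Φ : (Σ a, B a) → K := fun x => RelCWComplex.map x.1.1 x.1.2 x.2
  have hΦ (a) : Continuous fun x : B a => Φ ⟨a, x⟩ :=
    (RelCWComplex.continuousOn (C := (Set.univ : Set K)) a.1 a.2).domRestrict
  have hcont : Continuous Φ := continuous_sigma hΦ
  have hsurj : Function.Surjective Φ := fun k => by
    have hk : k ∈ ⋃ (n) (j : RelCWComplex.cell (Set.univ : Set K) n), RelCWComplex.closedCell n j :=
      (CWComplex.union (C := (Set.univ : Set K))).symm ▸ Set.mem_univ k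
    simp only [Set.mem_iUnion] at hk
    obtain ⟨n, j, x, hx, rfl⟩ := hk
    exact ⟨⟨⟨n, j⟩, x, hx⟩, rfl⟩
  refine (IsQuotientMap.locallyPathConnectedSpace
    (isQuotientMap_iff_isClosed.2 ⟨hsurj, fun A => ⟨fun h => h.preimage hcont, fun h => ?_⟩⟩))
  refine CWComplex.closed' (C := (Set.univ : Set K)) A (Set.subset_univ _) fun n j => ?_
  have : A ∩ RelCWComplex.map (C := (Set.univ : Set K)) n j '' Metric.closedBall 0 1 =
      (fun x : B ⟨n, j⟩ => Φ ⟨⟨n, j⟩, x⟩) '' ((fun x => Φ ⟨⟨n, j⟩, x⟩) ⁻¹' A) := by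
    ext k
    constructor
    · rintro ⟨hk, x, hx, rfl⟩
      exact ⟨⟨x, hx⟩, hk, rfl⟩
    · rintro ⟨x, hx, rfl⟩
      exact ⟨hx, x, x.2, rfl⟩
  change IsClosed (A ∩ RelCWComplex.map (C := (Set.univ : Set K)) n j '' Metric.closedBall 0 1)
  rw [this]
  exact ((h.preimage continuous_sigmaMk).isCompact.image (hΦ _)).isClosed

/-- A map to the Warsaw circle from a locally path connected space is nullhomotopic. -/
theorem nullhomotopic_of_locallyPathConnectedSpace {Z : Type*} [TopologicalSpace Z]
    [LocallyPathConnectedSpace Z] (f : C(Z, warsawCircle)) : f.Nullhomotopic := by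
  have := ((id_nullhomotopic HalfLine).comp_left (liftParam f)).comp_right param
  rwa [ContinuousMap.id_comp, param_comp_liftParam] at this

/-- The homotopy inverse K → X starts from a locally path connected space, so it is nullhomotopic,
and with it the identity of X. -/
theorem contractibleSpace_of_isValid (h : IsValid warsawCircle) :
    ContractibleSpace warsawCircle := by
  obtain ⟨K, _, hK, ⟨e⟩⟩ := h
  have := hK.locallyPathConnectedSpace
  rw [contractible_iff_id_nullhomotopic]
  obtain ⟨y, hy⟩ := (nullhomotopic_of_locallyPathConnectedSpace e.invFun).comp_left e.toFun
  exact ⟨y, e.left_inv.symm.trans hy⟩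

/-! ### Singular chains and the main invariant. -/

/-- Precomposition with the parametrization identifies singular simplices. -/
instance : IsIso (TopCat.toSSet.map (TopCat.ofHom param)) := by
  rw [NatTrans.isIso_iff_isIso_app]
  intro n
  have : LocallyPathConnectedSpace (stdSimplex ℝ (Fin (n.unop.len + 1))) :=
    (convex_stdSimplex ℝ _).locallyPathConnectedSpace
  have h (x) : TopCat.toSSetObjEquiv (TopCat.of warsawCircle) n
      ((TopCat.toSSet.map (TopCat.ofHom param)).app n x) =
      param.comp (TopCat.toSSetObjEquiv (TopCat.of HalfLine) n x) := rfl
  rw [isIso_iff_bijective]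
  constructor
  · intro x y hxy
    apply (TopCat.toSSetObjEquiv (TopCat.of HalfLine) n).injective
    have := (h x).symm.trans ((congrArg _ hxy).trans (h y))
    ext1 s
    exact (paramInv_param _).symm.trans
      ((congrArg paramInv (DFunLike.congr_fun this s)).trans (paramInv_param _))
  · intro y
    refine ⟨(TopCat.toSSetObjEquiv (TopCat.of HalfLine) n).symm
      (liftParam (TopCat.toSSetObjEquiv (TopCat.of warsawCircle) n y)), ?_⟩
    apply (TopCat.toSSetObjEquiv (TopCat.of warsawCircle) n).injective
    rw [h, Equiv.apply_symm_apply]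
    exact param_comp_liftParam _

instance : IsIso (singularChains.map (TopCat.ofHom param)) :=
  inferInstanceAs (IsIso (((SSet.chainComplexFunctor AddCommGrpCat.{0}).obj
    (AddCommGrpCat.of ℤ)).map (TopCat.toSSet.map (TopCat.ofHom param))))

theorem homotopic_comp_param (a b : C(warsawCircle, Circle)) :
    (a.comp param).Homotopic (b.comp param) := by
  obtain ⟨y, hy⟩ := (id_nullhomotopic HalfLine).comp_right (a.comp param)
  obtain ⟨z, hz⟩ := (id_nullhomotopic HalfLine).comp_right (b.comp param)
  have : PathConnectedSpace Circle :=
    Circle.exp_surjective.pathConnectedSpace Circle.exp.continuous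
  obtain ⟨p⟩ := PathConnectedSpace.joined y z
  exact (hy.trans ⟨p.toHomotopyConst⟩).trans hz.symm

/-- After composition with `param` any two maps are homotopic, and `param` can be cancelled because
it is an isomorphism on singular chains. -/
theorem mainInvariant_eq (s t : HomotopyClasses warsawCircle Circle) :
    mainInvariant s = mainInvariant t := by
  induction s using Quotient.inductionOn with | _ a
  induction t using Quotient.inductionOn with | _ b
  have h : mainInvariant (HomotopyClasses.mk (a.comp param)) =
      mainInvariant (HomotopyClasses.mk (b.comp param)) :=
    congrArg mainInvariant (Quotient.sound (homotopic_comp_param a b))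
  have h' (c : C(warsawCircle, Circle)) : mainInvariant (HomotopyClasses.mk (c.comp param)) =
      (HomotopyCategory.quotient _ _).map (singularChains.map (TopCat.ofHom param)) ≫
        mainInvariant (HomotopyClasses.mk c) := by
    change (HomotopyCategory.quotient _ _).map (singularChains.map
      (TopCat.ofHom param ≫ TopCat.ofHom c)) = _
    rw [Functor.map_comp, Functor.map_comp]
    rfl
  rw [h', h', cancel_epi] at h
  exact h

/-! ### The weak homotopy type. -/

instance : PathConnectedSpace warsawCircle :=
  Function.Surjective.pathConnectedSpace (f := param) (fun p => ⟨_, param_paramInv p⟩)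
    param.continuous

instance {n : ℕ} (x : warsawCircle) : Subsingleton (HomotopyGroup.Pi n warsawCircle x) := by
  suffices ∀ p : GenLoop (Fin n) warsawCircle x, GenLoop.Homotopic p GenLoop.const from
    ⟨fun a b => Quotient.inductionOn₂ a b fun p q =>
      Quotient.sound ((this p).trans (this q).symm)⟩
  intro p
  have hconv (s : I) (t : HalfLine) :
      -1 ≤ (1 - (s : ℝ)) * t + s * (paramInv x : ℝ) := by
    have h1 : (-1 : ℝ) ≤ t := t.2
    have h2 : (-1 : ℝ) ≤ paramInv x := (paramInv x).2
    nlinarith [s.2.1, s.2.2]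
  have : LocallyPathConnectedSpace (Fin n → I) := by
    have : LocallyPathConnectedSpace I := (convex_Icc (0 : ℝ) 1).locallyPathConnectedSpace
    infer_instance
  -- The lifted cube is contracted linearly to `paramInv x`; its boundary already lies there and
  -- stays fixed.
  let q := liftParam p.1
  refine ⟨⟨⟨⟨fun z => param ⟨(1 - (z.1 : ℝ)) * q z.2 + z.1 * (paramInv x : ℝ), hconv _ _⟩,
    ?_⟩, ?_, ?_⟩, ?_⟩⟩
  · exact param.continuous.comp (Continuous.subtype_mk (by fun_prop) _)
  · intro y
    simpa using DFunLike.congr_fun (param_comp_liftParam p.1) y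
  · intro y
    simpa using param_paramInv x
  · intro s y hy
    have : q y = paramInv x := congrArg paramInv (p.2 y hy)
    have h : (⟨(1 - (s : ℝ)) * q y + s * (paramInv x : ℝ), hconv _ _⟩ : HalfLine) =
        paramInv x := Subtype.ext (by rw [this]; ring)
    exact ((congrArg param h).trans (param_paramInv x)).trans (p.2 y hy).symm

theorem isWeakHomotopyEquiv_const_warsawCircle :
    IsWeakHomotopyEquiv (ContinuousMap.const warsawCircle PUnit.unit.{1}) := by
  have (x : PUnit.{1}) (n : ℕ) : Subsingleton (HomotopyGroup.Pi n PUnit x) :=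
    ⟨fun a b => Quotient.inductionOn₂ a b fun p q =>
      congrArg _ (GenLoop.ext _ _ fun _ => rfl)⟩
  have h1 : Subsingleton (ZerothHomotopy warsawCircle) :=
    (pathConnectedSpace_iff_zerothHomotopy.1 inferInstance).2
  have h2 : Subsingleton (ZerothHomotopy PUnit.{1}) :=
    (pathConnectedSpace_iff_zerothHomotopy.1 inferInstance).2
  have h3 : Nonempty (ZerothHomotopy warsawCircle) :=
    (pathConnectedSpace_iff_zerothHomotopy.1 inferInstance).1
  exact ⟨⟨Function.injective_of_subsingleton _, fun y => h3.elim fun x => ⟨x, Subsingleton.elim _ _⟩⟩,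
    fun n x => ⟨Function.injective_of_subsingleton _, fun y => ⟨default, Subsingleton.elim _ _⟩⟩⟩

theorem isCWComplex_punit : IsCWComplex PUnit.{1} :=
  ⟨inferInstance, ⟨CWComplex.ofDiscreteTopology⟩⟩

theorem isFinitary_warsawCircle : IsFinitary warsawCircle :=
  ⟨PUnit, inferInstance, isCWComplex_punit, inferInstance, Relation.EqvGen.rel _ _
    ⟨_, isWeakHomotopyEquiv_const_warsawCircle⟩⟩

open Filter

/-! ### Angles -/

/-- Angles of one point differ by multiples of 2π, so angles closer than 1 coincide. -/
theorem eventually_eq_of_exp_eq {T : Type*} [TopologicalSpace T] {h : T → ℝ} {t₀ : T}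
    (hc : ContinuousAt h t₀) (he : ∀ t, Circle.exp (h t) = Circle.exp (h t₀)) :
    ∀ᶠ t in 𝓝 t₀, h t = h t₀ := by
  filter_upwards [Metric.tendsto_nhds.1 hc 1 one_pos] with t ht
  obtain ⟨m, hm⟩ := Circle.exp_eq_exp.1 (he t)
  rw [Real.dist_eq, hm, add_sub_cancel_left, abs_lt] at ht
  have hp := pi_gt_three
  have h1 : m < 1 := by
    by_contra! hm1
    have : (1 : ℝ) ≤ m := by exact_mod_cast hm1
    nlinarith
  have h2 : -1 < m := by
    by_contra! hm1
    have : (m : ℝ) ≤ -1 := by exact_mod_cast hm1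
    nlinarith
  obtain rfl : m = 0 := by lia
  simpa using hm

theorem eq_of_exp_eq_const {T : Type*} [TopologicalSpace T] [PreconnectedSpace T] {h : T → ℝ}
    (hc : Continuous h) {z : Circle} (he : ∀ t, Circle.exp (h t) = z) (t t' : T) : h t = h t' :=
  ((IsLocallyConstant.iff_eventually_eq h).2 fun t₀ =>
    eventually_eq_of_exp_eq hc.continuousAt fun t => (he t).trans (he t₀).symm).apply_eq_of_preconnectedSpace
      t t'

theorem exp_pi_ne_one : Circle.exp π ≠ 1 := fun h => by
  have := congrArg (fun z : Circle => (z : ℂ)) h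
  simp only [Circle.coe_exp, Complex.exp_pi_mul_I, Circle.coe_one] at this
  norm_num at this

theorem continuousAt_circle_arg {z : Circle} (h : z ≠ Circle.exp π) :
    ContinuousAt (fun z : Circle => Complex.arg z) z := by
  refine (Complex.continuousAt_arg ?_).comp continuous_subtype_val.continuousAt
  rw [Complex.mem_slitPlane_iff_arg]
  exact ⟨fun h' => h (by rw [← h', Circle.exp_arg]), z.coe_ne_zero⟩

/-! ### The degree -/

/-- The part of the half-line that is mapped to the graph of `sin (1 / x)`. -/
def onGraph : C(ℝ, HalfLine) where
  toFun s := ⟨graphStart + max 0 s, by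
    have := one_div_pi_pos
    have := le_max_left 0 s
    rw [Set.mem_Ici, graphStart]; linarith⟩
  continuous_toFun :=
    (by fun_prop : Continuous fun s : ℝ => graphStart + max 0 s).subtype_mk fun _ => _

/-- The point of the half-line that is mapped to the segment `{0} × [-1, 1]`, to the height of
the image of `onGraph s`. -/
def onAxis : C(ℝ, HalfLine) where
  toFun s := ⟨-sin (π + max 0 s), by
    rw [Set.mem_Ici]; linarith [sin_le_one (π + max 0 s)]⟩
  continuous_toFun := (by fun_prop : Continuous fun s : ℝ => -sin (π + max 0 s)).subtype_mk fun _ => _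

theorem param_onGraph (s : ℝ) :
    (param (onGraph s) : ℝ × ℝ) = (1 / (π + max 0 s), sin (π + max 0 s)) := by
  refine (planeParam_graph (t := graphStart + max 0 s) (by linarith [le_max_left 0 s])).trans ?_
  rw [add_sub_cancel_left]

theorem param_onAxis (s : ℝ) : (param (onAxis s) : ℝ × ℝ) = (0, sin (π + max 0 s)) := by
  have h : planeParam (-sin (π + max 0 s)) = (0, sin (π + max 0 s)) := by
    rw [planeParam_axis (by linarith [neg_one_le_sin (π + max 0 s)]), neg_neg]
  exact h

theorem tendsto_uniformity_param :
    Tendsto (fun s => (param (onAxis s), param (onGraph s))) atTop (uniformity warsawCircle) := by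
  rw [tendsto_uniformity_iff_dist_tendsto_zero]
  have h : Tendsto (fun s : ℝ => 1 / (π + max 0 s)) atTop (𝓝 0) := by
    simp_rw [one_div]
    refine tendsto_inv_atTop_zero.comp (tendsto_atTop_add_const_left _ _ ?_)
    exact tendsto_atTop_mono (fun s => le_max_right 0 s) tendsto_id
  refine h.congr fun s => ?_
  have hp : 0 < 1 / (π + max 0 s) := by positivity
  rw [Subtype.dist_eq, param_onAxis, param_onGraph, Prod.dist_eq, dist_self, Real.dist_eq,
    zero_sub, abs_neg, abs_of_pos hp]
  exact (max_eq_left hp.le).symm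

/-- Continuous functions on the Warsaw circle take close values on the graph near the axis and on
the axis. -/
theorem tendsto_uniformity_comp_param {V : Type*} [UniformSpace V] (f : C(warsawCircle, V)) :
    Tendsto (fun s => (f (param (onAxis s)), f (param (onGraph s)))) atTop (uniformity V) := by
  intro r hr
  -- This is the segment {0} × [-1, 1]; a continuous map is uniformly continuous at a compact set.
  have hK : IsCompact (param '' ((↑) ⁻¹' Set.Icc (-1 : ℝ) 1)) :=
    (isClosed_Ici.isClosedEmbedding_subtypeVal.isCompact_preimage isCompact_Icc).image
      param.continuous
  have : ∀ᶠ s in atTop, (param (onAxis s), param (onGraph s)) ∈ _ := tendsto_uniformity_param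
    (hK.uniformContinuousAt_of_continuousAt f (fun _ _ => f.continuous.continuousAt) hr)
  rw [mem_map]
  filter_upwards [this] with s hs
  refine hs ⟨onAxis s, ?_, rfl⟩
  change -sin _ ∈ Set.Icc (-1 : ℝ) 1
  exact ⟨by linarith [sin_le_one (π + max 0 s)], by linarith [neg_one_le_sin (π + max 0 s)]⟩

/-- A continuous angle function of a map to the circle along the half-line. -/
def IsAngle (a : C(warsawCircle, Circle)) (θ : C(HalfLine, ℝ)) : Prop :=
  ∀ t, Circle.exp (θ t) = a (param t)

theorem exists_isAngle (a : C(warsawCircle, Circle)) : ∃ θ, IsAngle a θ := by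
  obtain ⟨θ, ⟨-, h⟩, -⟩ := Circle.isCoveringMap_exp.existsUnique_continuousMap_lifts
    (a.comp param) (onAxis 0) _ (Circle.exp_arg (a (param (onAxis 0))))
  exact ⟨θ, congrFun h⟩

/-- The map `a` has degree `n`: in the limit, its angle increases by `2 π n` from the axis to the
nearby graph. -/
def HasDegree (a : C(warsawCircle, Circle)) (n : ℤ) : Prop :=
  ∃ θ, IsAngle a θ ∧ Tendsto (fun s => θ (onGraph s) - θ (onAxis s)) atTop (𝓝 (2 * π * n))

/-- The exponential of the angle difference `D` tends to 1, hence eventually avoids `Circle.exp π`.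
From then on `D` minus the principal argument is continuous with values in 2πℤ, so constant, while
the principal argument tends to 0. -/
theorem exists_hasDegree (a : C(warsawCircle, Circle)) : ∃ n, HasDegree a n := by
  obtain ⟨θ, hθ⟩ := exists_isAngle a
  set D : ℝ → ℝ := fun s => θ (onGraph s) - θ (onAxis s) with hD
  have hDc : Continuous D := by fun_prop
  have hu : Tendsto (fun s => Circle.exp (D s)) atTop (𝓝 1) := by
    have := tendsto_uniformity_comp_param a
    rw [uniformity_eq_comap_nhds_one, tendsto_comap_iff] at this
    refine this.congr fun s => ?_
    rw [hD, Circle.exp_sub, hθ, hθ]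
    rfl
  have hne : ∀ᶠ s in atTop, Circle.exp (D s) ≠ Circle.exp π :=
    hu.eventually_ne fun h => exp_pi_ne_one h.symm
  obtain ⟨s₀, hs₀⟩ := eventually_atTop.1 hne
  -- Truncation by `max s₀ s` makes the function continuous on the whole connected line.
  have hconst := eq_of_exp_eq_const (T := ℝ) (z := 1)
    (h := fun s => D (max s₀ s) - Complex.arg (Circle.exp (D (max s₀ s)))) ?_ ?_
  · have hz : Circle.exp (D (max s₀ s₀) - Complex.arg (Circle.exp (D (max s₀ s₀)))) = 1 := by
      rw [Circle.exp_sub, Circle.exp_arg, div_self']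
    obtain ⟨n, hn⟩ := Circle.exp_eq_one.1 hz
    refine ⟨n, θ, hθ, ?_⟩
    have harg : Tendsto (fun s => 2 * π * n + Complex.arg (Circle.exp (D s))) atTop
        (𝓝 (2 * π * n + 0)) := by
      refine tendsto_const_nhds.add ?_
      have := (continuousAt_circle_arg exp_pi_ne_one.symm).tendsto.comp hu
      simpa only [Circle.coe_one, Complex.arg_one, Function.comp_def] using this
    rw [add_zero] at harg
    refine harg.congr' ?_
    filter_upwards [eventually_ge_atTop s₀] with s hs
    have := hconst s s₀
    rw [hn, max_eq_right hs] at this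
    linarith
  · refine (hDc.comp (by fun_prop)).sub (continuous_iff_continuousAt.2 fun s => ?_)
    exact (continuousAt_circle_arg (hs₀ _ (le_max_left _ _))).comp
      (f := fun s => Circle.exp (D (max s₀ s))) (by fun_prop)
  · intro s
    rw [Circle.exp_sub, Circle.exp_arg, div_self']

theorem HasDegree.mul {a b : C(warsawCircle, Circle)} {m n : ℤ} (ha : HasDegree a m)
    (hb : HasDegree b n) : HasDegree (a * b) (m + n) := by
  obtain ⟨θ, hθ, h⟩ := ha
  obtain ⟨η, hη, h'⟩ := hb
  refine ⟨θ + η, fun t => ?_, ?_⟩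
  · simp [Circle.exp_add, hθ t, hη t]
  · convert! h.add h' using 2
    · simp only [ContinuousMap.add_apply]; ring
    · push_cast; ring

/-- Two angle functions of one map differ by a constant, so any of them computes the degree. -/
theorem IsAngle.tendsto_of_hasDegree {a : C(warsawCircle, Circle)} {θ : C(HalfLine, ℝ)}
    (hθ : IsAngle a θ) {n : ℤ} (h : HasDegree a n) :
    Tendsto (fun s => θ (onGraph s) - θ (onAxis s)) atTop (𝓝 (2 * π * n)) := by
  obtain ⟨η, hη, h⟩ := h
  refine h.congr fun s => ?_
  have := eq_of_exp_eq_const (z := 1) (h := fun t => θ t - η t) (by fun_prop)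
    (fun t => by rw [Circle.exp_sub, hθ, hη, div_self']) (onGraph s) (onAxis s)
  linarith

theorem HasDegree.unique {a : C(warsawCircle, Circle)} {m n : ℤ} (hm : HasDegree a m)
    (hn : HasDegree a n) : m = n := by
  obtain ⟨θ, hθ, h⟩ := hm
  have := tendsto_nhds_unique h (hθ.tendsto_of_hasDegree hn)
  exact_mod_cast mul_left_cancel₀ two_pi_pos.ne' this

/-- A map that lifts to the line has degree zero. -/
theorem hasDegree_zero_of_exp {a : C(warsawCircle, Circle)} (g : C(warsawCircle, ℝ))
    (h : ∀ x, Circle.exp (g x) = a x) : HasDegree a 0 := by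
  refine ⟨g.comp param, fun t => h _, ?_⟩
  have := tendsto_uniformity_comp_param g
  rw [uniformity_eq_comap_nhds_zero, tendsto_comap_iff] at this
  simpa [Function.comp_def] using this

/-- The degree of a map from the Warsaw circle to the circle. -/
def degree (a : C(warsawCircle, Circle)) : ℤ := (exists_hasDegree a).choose

theorem hasDegree_degree (a : C(warsawCircle, Circle)) : HasDegree a (degree a) :=
  (exists_hasDegree a).choose_spec

theorem HasDegree.degree_eq {a : C(warsawCircle, Circle)} {n : ℤ} (h : HasDegree a n) :
    degree a = n :=
  (hasDegree_degree a).unique h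

theorem degree_mul (a b : C(warsawCircle, Circle)) : degree (a * b) = degree a + degree b :=
  ((hasDegree_degree a).mul (hasDegree_degree b)).degree_eq

theorem degree_eq_of_homotopic {a b : C(warsawCircle, Circle)} (h : a.Homotopic b) :
    degree a = degree b := by
  obtain ⟨F⟩ := h
  -- This homotopy from 1 to `b / a` lifts to ℝ starting at 0, so `b / a` has a real logarithm on
  -- all of X and its degree is 0.
  let H : C(I × warsawCircle, Circle) := ⟨fun z => F z / a z.2, by fun_prop⟩
  have h0 (x) : H (0, x) = Circle.exp ((0 : C(warsawCircle, ℝ)) x) := by simp [H]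
  let G := Circle.isCoveringMap_exp.liftHomotopy H 0 h0
  have hG := congrFun (Circle.isCoveringMap_exp.liftHomotopy_lifts H 0 h0)
  have hz : HasDegree (b / a) 0 :=
    hasDegree_zero_of_exp (G.comp ⟨fun x => (1, x), by fun_prop⟩) fun x => by
      refine (hG (1, x)).trans ?_
      simp [H]
  have := degree_mul (b / a) a
  rw [div_mul_cancel, hz.degree_eq, zero_add] at this
  exact this.symm

/-! ### Straightness of the degree. -/

/-- A linear relation between continuous maps that holds pointwise in the free abelian group is
satisfied by their degrees. -/
theorem sum_degree_eq_zero (s : Finset C(warsawCircle, Circle))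
    (n : C(warsawCircle, Circle) → ℤ)
    (h : ∀ (g : Circle → ℝ) x, ∑ a ∈ s, n a * g (a x) = 0) :
    ∑ a ∈ s, n a * degree a = 0 := by
  choose θ hθ using exists_isAngle
  have hlc : IsLocallyConstant fun t => ∑ a ∈ s, n a * θ a t := by
    rw [IsLocallyConstant.iff_eventually_eq]
    intro t₀
    classical
    have : Infinite Circle := by
      have := Set.Ioc.infinite (neg_lt_self pi_pos)
      exact Infinite.of_injective _ Circle.argEquiv.symm.injective
    -- The rotated argument `g` jumps only at `p`, which is none of the finitely many values at
    -- `t₀`, so each `θ a - g ∘ a ∘ param` is constant near `t₀`. The hypothesis `h` applies to `g`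
    -- although it is discontinuous.
    obtain ⟨p, hp⟩ := Infinite.exists_notMem_finset (s.image fun a => a (param t₀))
    let q := p / Circle.exp π
    let g : Circle → ℝ := fun y => Complex.arg (y / q : Circle)
    have hev : ∀ a ∈ s, ∀ᶠ t in 𝓝 t₀,
        θ a t - g (a (param t)) = θ a t₀ - g (a (param t₀)) := by
      intro a ha
      refine eventually_eq_of_exp_eq (h := fun t => θ a t - g (a (param t))) ?_ fun t => ?_
      · refine (θ a).continuous.continuousAt.sub ?_
        refine (continuousAt_circle_arg ?_).comp (f := fun t => a (param t) / q) (by fun_prop)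
        intro he
        refine hp (Finset.mem_image.2 ⟨a, ha, ?_⟩)
        rw [div_eq_iff_eq_mul] at he
        rw [he]
        simp [q]
      · simp only [Circle.exp_sub, g, Circle.exp_arg, hθ a _]
        simp
    filter_upwards [(Finset.eventually_all s).2 hev] with t ht
    have key (t) : ∑ a ∈ s, n a * θ a t = ∑ a ∈ s, n a * (θ a t - g (a (param t))) := by
      simp_rw [mul_sub]
      rw [Finset.sum_sub_distrib, h g, sub_zero]
    rw [key, key t₀]
    exact Finset.sum_congr rfl fun a ha => by rw [ht a ha]
  have hlim : Tendsto (fun r => ∑ a ∈ s, n a * (θ a (onGraph r) - θ a (onAxis r))) atTop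
      (𝓝 (∑ a ∈ s, n a * (2 * π * degree a))) :=
    tendsto_finsetSum _ fun a _ =>
      ((hθ a).tendsto_of_hasDegree (hasDegree_degree a)).const_mul _
  have hzero (r) : ∑ a ∈ s, n a * (θ a (onGraph r) - θ a (onAxis r)) = 0 := by
    simp_rw [mul_sub]
    rw [Finset.sum_sub_distrib, sub_eq_zero]
    exact hlc.apply_eq_of_preconnectedSpace _ _
  simp_rw [hzero] at hlim
  have := tendsto_nhds_unique hlim tendsto_const_nhds
  have h2 : 2 * π * ((∑ a ∈ s, n a * degree a : ℤ) : ℝ) = 0 := by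
    rw [← this]
    push_cast
    rw [Finset.mul_sum]
    exact Finset.sum_congr rfl fun a _ => by ring
  exact_mod_cast (mul_eq_zero.1 h2).resolve_left two_pi_pos.ne'

/-- The degree as a homotopy invariant. -/
def degreeInvariant : HomotopyClasses warsawCircle Circle → ℚ :=
  Quotient.lift (fun a => (degree a : ℚ)) fun _ _ h => by rw [degree_eq_of_homotopic h]

theorem isStraight_degreeInvariant : IsStraight degreeInvariant := by
  let Ψ : FreeAbelianGroup C(warsawCircle, Circle) →+ L warsawCircle Circle :=
    FreeAbelianGroup.lift fun a => L.ofMap a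
  let Δ : FreeAbelianGroup C(warsawCircle, Circle) →+ ℚ :=
    FreeAbelianGroup.lift fun a => (degree a : ℚ)
  have hker : Ψ.ker ≤ Δ.ker := by
    intro w hw
    obtain ⟨v, hv⟩ : ∃ v : C(warsawCircle, Circle) →₀ ℤ,
        w = ∑ a ∈ v.support, v a • FreeAbelianGroup.of a := by
      refine ⟨FreeAbelianGroup.toFinsupp w, ?_⟩
      conv_lhs => rw [← Finsupp.toFreeAbelianGroup_toFinsupp w]
      simp [Finsupp.toFreeAbelianGroup, Finsupp.sum]
    have hsum := sum_degree_eq_zero v.support v fun g x => by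
      -- Evaluation at `x` followed by the linear extension of `g` turns a relation in L into a
      -- numerical one.
      let E : L warsawCircle Circle →+ ℝ := ((FreeAbelianGroup.lift g).comp
        (AddMonoidHom.eval (FreeAbelianGroup.of x))).comp (AddSubgroup.subtype _)
      have hE (a : C(warsawCircle, Circle)) : E (Ψ (FreeAbelianGroup.of a)) = g (a x) := by
        simp [E, Ψ, L.ofMap]
      have h0 : E (Ψ w) = 0 := by rw [AddMonoidHom.mem_ker.1 hw, map_zero]
      rw [hv, map_sum, map_sum] at h0
      simp only [map_zsmul, hE] at h0
      simpa only [zsmul_eq_mul] using h0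
    have hΔ (a : C(warsawCircle, Circle)) : Δ (FreeAbelianGroup.of a) = degree a :=
      FreeAbelianGroup.lift_apply_of _ _
    rw [AddMonoidHom.mem_ker, hv, map_sum]
    simp only [map_zsmul, hΔ]
    simp only [zsmul_eq_mul]
    exact_mod_cast hsum
  -- The degree is now defined on the image of `Ψ`; injectivity of ℚ extends it to L.
  obtain ⟨F, hF⟩ := (Module.Baer.of_divisible ℚ).extension_property_addMonoidHom
    (QuotientAddGroup.kerLift Ψ) (QuotientAddGroup.kerLift_injective Ψ)
    (QuotientAddGroup.lift Ψ.ker Δ hker)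
  refine ⟨F, fun a => ?_⟩
  have := DFunLike.congr_fun hF (QuotientAddGroup.mk (FreeAbelianGroup.of a))
  simp [Ψ, Δ] at this
  exact this.symm

/-! ### A map of degree one. -/

/-- A map that winds once around the circle along the bottom of the Warsaw circle. -/
def windOnce : C(warsawCircle, Circle) where
  toFun p := if p.1.2 ≤ -(3 / 2) then Circle.exp (2 * π * (π * p.1.1)) else 1
  continuous_toFun := by
    -- At height -3/2 only the axis and the right edge occur, and on both the exponential is 1.
    refine Continuous.if_le (by fun_prop) continuous_const (by fun_prop) continuous_const ?_
    intro p hp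
    have := pi_pos
    rcases mem_warsawCircle.1 p.2 with h | h | h | h
    · simp [h.1]
    · linarith [h.2.2]
    · rw [h.1, mul_one_div_cancel this.ne', mul_one, Circle.exp_two_pi]
    · linarith [h.2.2, neg_one_le_sin (1 / p.1.1)]

/-- The angle rises from 0 to 2π over [2, 2 + 1/π] and is constant elsewhere; `onAxis` stays before
this interval and `onGraph` after it, so the difference is exactly 2π. -/
theorem hasDegree_windOnce : HasDegree windOnce 1 := by
  refine ⟨⟨fun t => 2 * π * min (max 0 (π * (t - 2))) 1, by fun_prop⟩, fun t => ?_, ?_⟩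
  · have hp := pi_pos
    have h1 := one_div_pi_pos
    have hc : graphStart = 4 + 1 / π := rfl
    obtain ⟨t, ht⟩ := t
    have hx : windOnce (param ⟨t, ht⟩) = if (planeParam t).2 ≤ -(3 / 2) then
      Circle.exp (2 * π * (π * (planeParam t).1)) else 1 := rfl
    rw [hx]
    simp only [ContinuousMap.coe_mk]
    rcases le_total t 2 with h | h
    · rw [planeParam_axis h, max_eq_left (by nlinarith)]
      simp
    rcases le_total t (2 + 1 / π) with h' | h'
    · have : π * (t - 2) ≤ 1 := by
        rw [← le_div_iff₀' hp]; linarith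
      rw [planeParam_bottom h h', max_eq_right (by nlinarith), min_eq_left this,
        if_pos (by norm_num)]
    have : 1 ≤ π * (t - 2) := by
      rw [← div_le_iff₀' hp]; linarith
    rw [min_eq_right (this.trans (le_max_right _ _)), mul_one, Circle.exp_two_pi]
    rcases le_total t graphStart with h3 | h3
    · rw [planeParam_edge h' h3, mul_one_div_cancel hp.ne', mul_one, Circle.exp_two_pi, ite_self]
    · rw [planeParam_graph h3, if_neg]
      linarith [neg_one_le_sin (π + (t - graphStart))]
  · refine tendsto_const_nhds.congr fun s => ?_
    have hp := pi_gt_three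
    have h1 := one_div_pi_pos
    have hg : 1 ≤ π * (graphStart + max 0 s - 2) := by
      have : 1 ≤ graphStart + max 0 s - 2 := by
        rw [graphStart]; linarith [le_max_left 0 s]
      nlinarith
    have ha : π * (-sin (π + max 0 s) - 2) ≤ 0 := by
      nlinarith [neg_one_le_sin (π + max 0 s)]
    change _ = 2 * π * min (max 0 (π * (graphStart + max 0 s - 2))) 1 -
      2 * π * min (max 0 (π * (-sin (π + max 0 s) - 2))) 1
    rw [min_eq_right (hg.trans (le_max_right _ _)), max_eq_left ha]
    simp

/-! ### The circle as a CW-complex -/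

/-- The parametrization of the complement of a point in the circle by an open interval. -/
def circleArc : PartialEquiv (Fin 1 → ℝ) Circle where
  toFun x := Circle.exp (π * x 0)
  invFun z _ := Complex.arg z / π
  source := Metric.ball 0 1
  target := {Circle.exp π}ᶜ
  map_source' x hx := by
    have hp := pi_pos
    have h := abs_lt.1 ((norm_le_pi_norm x 0).trans_lt (mem_ball_zero_iff.1 hx))
    intro he
    have := congrArg (fun z : Circle => Complex.arg z) (Set.mem_singleton_iff.1 he)
    rw [Circle.arg_exp (by nlinarith) (by nlinarith), Circle.arg_exp (by linarith) le_rfl] at this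
    nlinarith
  map_target' z hz := by
    rw [mem_ball_zero_iff, pi_norm_lt_iff one_pos]
    intro
    rw [norm_div, Real.norm_eq_abs, Real.norm_of_nonneg pi_pos.le, div_lt_one pi_pos]
    refine lt_of_le_of_ne (Complex.abs_arg_le_pi _) fun h => ?_
    rcases abs_choice (Complex.arg z) with h' | h' <;> rw [h'] at h
    · exact hz (by rw [← h, Circle.exp_arg]; rfl)
    · linarith [Complex.neg_pi_lt_arg z]
  left_inv' x hx := by
    have hp := pi_pos
    have h := abs_lt.1 ((norm_le_pi_norm x 0).trans_lt (mem_ball_zero_iff.1 hx))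
    ext i
    rw [Circle.arg_exp (by nlinarith) (by nlinarith), mul_div_cancel_left₀ _ hp.ne',
      Subsingleton.elim i 0]
  right_inv' z _ := by rw [mul_div_cancel₀ _ pi_pos.ne', Circle.exp_arg]

/-- The cells of the circle: one in dimension zero and one in dimension one. -/
def CircleCell : ℕ → Type
  | 0 => PUnit
  | 1 => PUnit
  | _ + 2 => PEmpty

instance : Inhabited (CircleCell 0) := ⟨PUnit.unit⟩

instance : Inhabited (CircleCell 1) := ⟨PUnit.unit⟩

/-- The characteristic maps of the cells of the circle. -/
def circleCellMap : ∀ n, CircleCell n → PartialEquiv (Fin n → ℝ) Circle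
  | 0, _ => PartialEquiv.single 0 (Circle.exp π)
  | 1, _ => circleArc
  | _ + 2, i => i.elim

theorem image_circleCellMap_zero (i : CircleCell 0) (S : Set (Fin 0 → ℝ)) (h : S.Nonempty) :
    circleCellMap 0 i '' S = {Circle.exp π} :=
  h.image_const _

theorem image_circleCellMap_one (i : CircleCell 1) :
    circleCellMap 1 i '' Metric.ball 0 1 = {Circle.exp π}ᶜ :=
  circleArc.image_source_eq_target

theorem isCWComplex_circle : IsCWComplex Circle := by
  refine ⟨inferInstance, ⟨CWComplex.mkFinite _ CircleCell circleCellMap ?_ ?_ ?_ ?_ ?_ ?_ ?_ ?_⟩⟩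
  · filter_upwards [Filter.eventually_ge_atTop 2] with n hn
    obtain ⟨m, rfl⟩ := Nat.exists_eq_add_of_le' hn
    exact inferInstanceAs (IsEmpty PEmpty)
  · rintro (_ | _ | n)
    · exact inferInstanceAs (Finite PUnit)
    · exact inferInstanceAs (Finite PUnit)
    · exact inferInstanceAs (Finite PEmpty)
  · rintro (_ | _ | n) i
    · exact (Set.eq_univ_of_forall fun x => Subsingleton.elim _ _).trans
        (Set.eq_univ_of_forall fun x => by simp [Subsingleton.elim x 0]).symm
    · rfl
    · exact i.elim
  · rintro (_ | _ | n) i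
    · exact continuousOn_const
    · exact Continuous.continuousOn (by
        change Continuous fun x : Fin 1 → ℝ => Circle.exp (π * x 0)
        fun_prop)
    · exact i.elim
  · rintro (_ | _ | n) i
    · exact continuousOn_const
    · refine continuousOn_pi.2 fun _ z hz => ContinuousAt.continuousWithinAt ?_
      exact (continuousAt_circle_arg hz).div_const _
    · exact i.elim
  · rintro ⟨_ | _ | n, i⟩ - ⟨_ | _ | m, j⟩ - h
    · exact absurd rfl h
    · change Disjoint (circleCellMap 0 i '' _) (circleCellMap 1 j '' _)
      rw [image_circleCellMap_zero _ _ ⟨0, Metric.mem_ball_self one_pos⟩, image_circleCellMap_one]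
      exact disjoint_compl_right
    · exact j.elim
    · change Disjoint (circleCellMap 1 i '' _) (circleCellMap 0 j '' _)
      rw [image_circleCellMap_zero _ _ ⟨0, Metric.mem_ball_self one_pos⟩, image_circleCellMap_one]
      exact disjoint_compl_left
    · exact absurd rfl h
    · exact j.elim
    · exact i.elim
    · exact i.elim
    · exact i.elim
  · rintro (_ | _ | n) i
    · intro x hx
      rw [Subsingleton.elim x 0, mem_sphere_zero_iff_norm, norm_zero] at hx
      exact absurd hx zero_ne_one
    · intro x hx
      refine Set.mem_iUnion₂.2 ⟨0, Nat.one_pos, Set.mem_iUnion.2 ⟨(default : CircleCell 0), ?_⟩⟩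
      rw [image_circleCellMap_zero _ _ ⟨0, Metric.mem_closedBall_self zero_le_one⟩]
      -- Both ends of the interval are glued to the 0-cell.
      change Circle.exp (π * x 0) = Circle.exp π
      have : |x 0| = 1 := by
        have h := mem_sphere_zero_iff_norm.1 hx
        rw [show x = fun _ => x 0 from funext fun i => congrArg x (Subsingleton.elim (α := Fin 1) i 0)] at h
        exact (pi_norm_const (ι := Fin 1) (x 0)).symm.trans h
      rcases eq_or_eq_neg_of_abs_eq this with h | h
      · rw [h, mul_one]
      · rw [h, Circle.exp_eq_exp]
        exact ⟨-1, by push_cast; ring⟩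
    · exact i.elim
  · refine Set.eq_univ_of_forall fun z => ?_
    simp only [Set.mem_iUnion]
    by_cases hz : z = Circle.exp π
    · refine ⟨0, (default : CircleCell 0), ?_⟩
      rw [image_circleCellMap_zero _ _ ⟨0, Metric.mem_closedBall_self zero_le_one⟩]
      exact hz
    · refine ⟨1, (default : CircleCell 1), Set.image_mono Metric.ball_subset_closedBall ?_⟩
      rw [image_circleCellMap_one]
      exact hz

theorem isValid_circle : IsValid Circle :=
  ⟨Circle, inferInstance, isCWComplex_circle, ⟨ContinuousMap.HomotopyEquiv.refl _⟩⟩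

/-- Contractibility would make `windOnce`, of degree 1, homotopic to a constant, of degree 0. -/
theorem not_isValid_warsawCircle : ¬ IsValid warsawCircle := by
  intro h
  have := contractibleSpace_of_isValid h
  obtain ⟨z, hz⟩ := (id_nullhomotopic warsawCircle).comp_right windOnce
  rw [ContinuousMap.comp_id] at hz
  have hd : HasDegree (ContinuousMap.const warsawCircle z) 0 :=
    hasDegree_zero_of_exp (.const _ (Complex.arg z)) fun _ => Circle.exp_arg z
  have := degree_eq_of_homotopic hz
  rw [hasDegree_windOnce.degree_eq, hd.degree_eq] at this
  exact one_ne_zero this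

end StraightInvariants

end

open StraightInvariants in
theorem mainTheorem9 :
    IsWeakHomotopyEquiv (ContinuousMap.const warsawCircle PUnit.unit.{1}) ∧
    IsFinitary warsawCircle ∧
    ¬ IsValid warsawCircle ∧
    IsValid Circle ∧
    (∀ s t : HomotopyClasses warsawCircle Circle, mainInvariant s = mainInvariant t) ∧
    ∃ f : HomotopyClasses warsawCircle Circle → ℚ,
      f ≠ 0 ∧
      (∀ a b : C(warsawCircle, Circle),
        f (HomotopyClasses.mk (a * b)) = f (HomotopyClasses.mk a) + f (HomotopyClasses.mk b)) ∧
      IsStraight f ∧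
      ¬ ∃ d : ChainHomotopyClasses warsawCircle Circle →+ ℚ, f = d ∘ mainInvariant := by
  have hne : degreeInvariant (HomotopyClasses.mk windOnce) = 1 := by
    change (degree windOnce : ℚ) = 1
    rw [hasDegree_windOnce.degree_eq, Int.cast_one]
  have hmul (a b : C(warsawCircle, Circle)) :
      degreeInvariant (HomotopyClasses.mk (a * b)) =
        degreeInvariant (HomotopyClasses.mk a) + degreeInvariant (HomotopyClasses.mk b) := by
    change ((degree (a * b) : ℤ) : ℚ) = degree a + degree b
    rw [degree_mul, Int.cast_add]
  refine ⟨isWeakHomotopyEquiv_const_warsawCircle, isFinitary_warsawCircle,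
    not_isValid_warsawCircle, isValid_circle, mainInvariant_eq, degreeInvariant, fun h => ?_, hmul,
    isStraight_degreeInvariant, ?_⟩
  · rw [h] at hne
    exact zero_ne_one hne
  · rintro ⟨d, hd⟩
    -- Factoring through h would make the degree constant, and a constant additive function is zero.
    have h1 := hmul 1 1
    have h2 : degreeInvariant (HomotopyClasses.mk windOnce) =
        degreeInvariant (HomotopyClasses.mk 1) := by
      rw [hd, Function.comp_apply, Function.comp_apply, mainInvariant_eq]
    rw [mul_one, ← h2, hne] at h1
    norm_num at h1
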